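/- Fix constants $\sigma_x>0$ and $c>0$. There exist positive constants $c_0,c_1,c_2,c_3$, with $c_1<1$, depending only on $\sigma_x$ and $c$, such that the following holds for all integers $p>n\ge 1$. Let $x$ be a mean-zero random vector in $\mathbb{R}^p$ with covariance matrix $\Sigma=\mathbb{E}[xx^\top]=\mathrm{diag}(\lambda_1,\dots,\lambda_p)$, $\lambda_1\ge\dots\ge\lambda_p>0$, such that $x=\Sigma^{1/2}u$, where the components of $u$ are independent and $\sigma_x^2$-sub-Gaussian, that is, $\mathbb{E}[\exp(\phi^\top u)]\le\exp(\sigma_x^2\|\phi\|^2/2)$ for all $\phi\in\mathbb{R}^p$. Let $X\in\mathbb{R}^{n\times p}$ be the random matrix whose rows $x_1,\dots,x_n$ are i.i.d. copies of $x$, and assume the anti-concentration condition $$\Pr\big[(\Sigma^{-1/2}X^\top\phi)_i\in[a,b]\big]\le c\,|b-a|\qquad\text{for every unit vector }\phi\in\mathbb{R}^n,\ \text{all } a\le b \text{ in } \mathbb{R}\text{ and all } i\in\{1,\dots,p\}.$$ For a nonempty $S\subseteq\{1,\dots,p\}$ let $X_S\in\mathbb{R}^{n\times|S|}$ be the submatrix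 of $X$ formed by the columns with index in $S$, and put $s(S)=\sum_{i\in S}\lambda_i$ and $r(S)=s(S)/\max_{i\in S}\lambda_i$. If $r(S)\ge c_0 n$, then for all $0\le t<c_1$ $$\Pr\big[\mu_n(X_SX_S^\top)\le t\,s(S)\big]\le (c_2t)^{c_3\,r(S)},$$ where $\mu_n(M)$ denotes the $n$-th largest, i.e. the smallest, eigenvalue of a symmetric $n\times n$ matrix $M$. -/

import Mathlib

open MeasureTheory ProbabilityTheory

noncomputable section

namespace BenignLinear

/-- The `j`-th largest eigenvalue (counted with multiplicity) of a real symmetric `n × n` matrix,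
where `j : Fin n` is a zero-based index: index `0` gives the largest eigenvalue `μ₁(M)`,
and index `n - 1` gives the smallest one `μₙ(M)`. -/
def orderedEigenvalue {n : ℕ} (M : Matrix (Fin n) (Fin n) ℝ) (hM : M.IsHermitian)
    (j : Fin n) : ℝ :=
  hM.eigenvalues₀ (Fin.cast (Fintype.card_fin n).symm j)

theorem orderedEigenvalue_antitone {n : ℕ} (M : Matrix (Fin n) (Fin n) ℝ)
    (hM : M.IsHermitian) : Antitone (orderedEigenvalue M hM) :=
  fun _ _ h => hM.eigenvalues₀_antitone h

/-- `X_S`: the submatrix of `X` made of the columns with index in `S`. -/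
def colSubmatrix {n p : ℕ} (X : Matrix (Fin n) (Fin p) ℝ) (S : Finset (Fin p)) :
    Matrix (Fin n) S ℝ :=
  X.submatrix id (fun j : S => (j : Fin p))

/-- `X_S X_Sᵀ`. -/
def gram {n p : ℕ} (X : Matrix (Fin n) (Fin p) ℝ) (S : Finset (Fin p)) :
    Matrix (Fin n) (Fin n) ℝ :=
  colSubmatrix X S * (colSubmatrix X S).transpose

theorem gram_isHermitian {n p : ℕ} (X : Matrix (Fin n) (Fin p) ℝ) (S : Finset (Fin p)) :
    (gram X S).IsHermitian := by
  have h := Matrix.isHermitian_mul_conjTranspose_self (colSubmatrix X S)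
  rwa [Matrix.conjTranspose_eq_transpose_of_trivial] at h

/-- `s(S) = ∑_{i ∈ S} λ_i`. -/
def partialTrace {p : ℕ} (lam : Fin p → ℝ) (S : Finset (Fin p)) : ℝ :=
  ∑ i ∈ S, lam i

/-- The effective rank `r(S) = s(S) / max_{i ∈ S} λ_i` of a nonempty set of indices. -/
def effectiveRank {p : ℕ} (lam : Fin p → ℝ) (S : Finset (Fin p)) (hS : S.Nonempty) : ℝ :=
  partialTrace lam S / S.sup' hS lam

/-- `Σ^{1/2}` for `Σ = diag(λ₁, …, λ_p)` with nonnegative entries. -/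
def covSqrt {p : ℕ} (lam : Fin p → ℝ) : Matrix (Fin p) (Fin p) ℝ :=
  Matrix.diagonal fun i => √(lam i)

theorem covSqrt_posSemidef {p : ℕ} (lam : Fin p → ℝ) : (covSqrt lam).PosSemidef :=
  Matrix.PosSemidef.diagonal fun i => Real.sqrt_nonneg (lam i)

theorem covSqrt_mul_self {p : ℕ} {lam : Fin p → ℝ} (h : ∀ i, 0 < lam i) :
    covSqrt lam * covSqrt lam = Matrix.diagonal lam := by
  simp [covSqrt, Matrix.diagonal_mul_diagonal, fun i => Real.mul_self_sqrt (h i).le]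

/-- `Σ^{-1/2}` for `Σ = diag(λ₁, …, λ_p)` with positive entries. -/
def covInvSqrt {p : ℕ} (lam : Fin p → ℝ) : Matrix (Fin p) (Fin p) ℝ :=
  Matrix.diagonal fun i => (√(lam i))⁻¹

theorem covInvSqrt_eq_inv {p : ℕ} {lam : Fin p → ℝ} (h : ∀ i, 0 < lam i) :
    covInvSqrt lam = (covSqrt lam)⁻¹ := by
  refine (Matrix.inv_eq_left_inv ?_).symm
  simp [covSqrt, covInvSqrt, Matrix.diagonal_mul_diagonal,
    fun i => inv_mul_cancel₀ (Real.sqrt_pos.mpr (h i)).ne']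

/-- The data matrix, whose `i`-th row is the `i`-th sample. -/
def dataMatrix {Ω : Type*} {n p : ℕ} (xs : Fin n → Ω → Fin p → ℝ) (ω : Ω) :
    Matrix (Fin n) (Fin p) ℝ :=
  Matrix.of fun i j => xs i ω j

/-- Assumptions on the distribution of the feature vector `x = Σ^{1/2} u`: it has mean zero, its
covariance matrix is `Σ = diag(λ₁, …, λ_p)` with `λ₁ ≥ … ≥ λ_p > 0`, and the components of `u` are
independent and `σx²`-sub-Gaussian. The exponential moments of `u` make all the expectations
below finite. -/
structure IsFeatureVector {Ω : Type*} [MeasurableSpace Ω] (P : Measure Ω) {p : ℕ}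
    (σx : ℝ) (lam : Fin p → ℝ) (x u : Ω → Fin p → ℝ) : Prop where
  lam_pos : ∀ i, 0 < lam i
  lam_antitone : Antitone lam
  measurable_x : Measurable x
  measurable_u : Measurable u
  mean_zero : ∀ i, ∫ ω, x ω i ∂P = 0
  covariance : (Matrix.of fun i j => ∫ ω, x ω i * x ω j ∂P) = Matrix.diagonal lam
  x_eq : ∀ᵐ ω ∂P, x ω = (covSqrt lam).mulVec (u ω)
  indep_components : iIndepFun (fun (i : Fin p) (ω : Ω) => u ω i) P
  subgaussian : ∀ φ : EuclideanSpace ℝ (Fin p),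
    Integrable (fun ω => Real.exp (∑ i, φ i * u ω i)) P ∧
      ∫ ω, Real.exp (∑ i, φ i * u ω i) ∂P ≤ Real.exp (σx ^ 2 * ‖φ‖ ^ 2 / 2)

/-- The samples `x₁, …, xₙ` are i.i.d. copies of `x`. -/
structure IsIIDSample {Ω : Type*} [MeasurableSpace Ω] (P : Measure Ω) {n p : ℕ}
    (x : Ω → Fin p → ℝ) (xs : Fin n → Ω → Fin p → ℝ) : Prop where
  measurable : ∀ i, Measurable (xs i)
  indep : iIndepFun xs P
  identDistrib : ∀ i, IdentDistrib (xs i) x P P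

/-- The anti-concentration (small-ball) condition with constant `c` on a random matrix `X`:
`Pr[(Σ^{-1/2} Xᵀ φ)_i ∈ [a, b]] ≤ c |b - a|` for every unit vector `φ ∈ ℝⁿ`, all `a ≤ b`
and every coordinate `i`. -/
def AntiConcentrated {Ω : Type*} [MeasurableSpace Ω] (P : Measure Ω) {n p : ℕ}
    (c : ℝ) (lam : Fin p → ℝ) (X : Ω → Matrix (Fin n) (Fin p) ℝ) : Prop :=
  ∀ φ : EuclideanSpace ℝ (Fin n), ‖φ‖ = 1 → ∀ a b : ℝ, a ≤ b → ∀ i : Fin p,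
    P.real {ω | (covInvSqrt lam).mulVec ((X ω).transpose.mulVec φ.ofLp) i ∈ Set.Icc a b}
      ≤ c * |b - a|

end BenignLinear

end

/-!
After dividing by `max_{i ∈ S} λ_i`, the quadratic form `φᵀ X_S X_Sᵀ φ` at a unit vector `φ` becomes
`∑ L_i w_i²`, with weights `L_i ∈ (0, 1]` summing to `r = r(S)` and `w_i = ⟨z_i, φ⟩`, where `z_i` is
the normalised `i`-th column of `X`. The columns are independent
(`IsIIDSample.iIndepFun_columns`, `iIndepFun_curry`), and each `w_i` is anti-concentrated and
sub-Gaussian with constants that do not depend on `φ`.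

Fixed direction. Since `L_i ≤ 1`, Jensen gives `E exp (θ L_i w_i²) ≤ (E exp (θ w_i²)) ^ L_i`, so a
bound `M` on the individual exponential moments, for `θ` of either sign, yields
`E exp (θ ∑ L_i w_i²) ≤ M ^ r` (`lintegral_exp_sum_sq_le`). It is this step that produces the
exponent `r(S)` whatever the spread of the `λ_i`. With `θ = -1 / t`, anti-concentration gives
`M ≲ t ^ (1 / 4)`, hence `P (∑ L_i w_i² ≤ 4 t r) ≤ (C t ^ (1 / 4)) ^ r` (`measureReal_sum_sq_le`).
With `θ` a small multiple of `σx⁻²`, sub-Gaussianity gives a constant `M`, hence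
`P (∑ L_i w_i² ≥ r / t) ≤ (C t) ^ r` (`measureReal_le_sum_sq`).

All directions. A `t / 2`-net of the unit sphere of `ℝⁿ` has at most `(5 / t) ^ n` points
(`exists_net_sphere`). If neither event occurs at any point of the net, then the upper bounds control
the operator norm and the lower bounds extend to the whole sphere (`lt_norm_apply_of_net`). As
`n ≤ r / 8`, the union bound costs only `(5 / t) ^ (r / 8)`, and `(C' t) ^ (r / 8)` remains.
-/

namespace BenignLinear

open scoped ENNReal NNReal

/-! ### Nets of the unit sphere -/

section Net

variable {E : Type*} [NormedAddCommGroup E] [NormedSpace ℝ E] [FiniteDimensional ℝ E]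

open scoped Function in
/-- Volume comparison: the balls of radius `ε / 2` around the points are disjoint and lie in the ball of
radius `1 + ε / 2`. -/
theorem card_le_of_separated_sphere {ε : ℝ} (hε : 0 < ε) (s : Finset E)
    (hs : ∀ x ∈ s, ‖x‖ = 1) (hsep : ∀ x ∈ s, ∀ y ∈ s, x ≠ y → ε < ‖x - y‖) :
    (s.card : ℝ) ≤ (1 + 2 / ε) ^ Module.finrank ℝ E := by
  borelize E
  let μ : Measure E := Measure.addHaar
  have hδ : 0 < ε / 2 := by positivity
  have hρ : 0 < 1 + ε / 2 := by positivity
  have hdisj : Set.Pairwise (s : Set E) (Disjoint on fun c => Metric.ball (c : E) (ε / 2)) := by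
    rintro c hc d hd hcd
    apply Metric.ball_disjoint_ball
    rw [dist_eq_norm]
    linarith [hsep c hc d hd hcd]
  have hsub : ⋃ c ∈ s, Metric.ball c (ε / 2) ⊆ Metric.ball (0 : E) (1 + ε / 2) := by
    refine Set.iUnion₂_subset fun x hx => Metric.ball_subset_ball' ?_
    rw [dist_zero_right, hs x hx, add_comm]
  have hvol : (s.card : ℝ≥0∞) * ENNReal.ofReal ((ε / 2) ^ Module.finrank ℝ E) *
      μ (Metric.ball 0 1) ≤
      ENNReal.ofReal ((1 + ε / 2) ^ Module.finrank ℝ E) * μ (Metric.ball 0 1) :=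
    calc
      _ = μ (⋃ c ∈ s, Metric.ball c (ε / 2)) := by
        rw [measure_biUnion_finset hdisj fun c _ => measurableSet_ball]
        simp only [μ.addHaar_ball_of_pos _ hδ, Finset.sum_const, nsmul_eq_mul, mul_assoc]
      _ ≤ μ (Metric.ball (0 : E) (1 + ε / 2)) := measure_mono hsub
      _ = _ := by simp only [μ.addHaar_ball_of_pos _ hρ]
  have hcard : (s.card : ℝ≥0∞) * ENNReal.ofReal ((ε / 2) ^ Module.finrank ℝ E) ≤
      ENNReal.ofReal ((1 + ε / 2) ^ Module.finrank ℝ E) :=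
    (ENNReal.mul_le_mul_iff_left (Metric.measure_ball_pos _ _ zero_lt_one).ne'
      measure_ball_lt_top.ne).1 hvol
  have hreal := ENNReal.toReal_le_of_le_ofReal (pow_nonneg hρ.le _) hcard
  rw [ENNReal.toReal_mul, ENNReal.toReal_natCast, ENNReal.toReal_ofReal (by positivity)] at hreal
  rw [show 1 + 2 / ε = (1 + ε / 2) / (ε / 2) by field_simp; ring, div_pow, le_div_iff₀ (by positivity)]
  exact hreal

/-- An `ε`-separated subset of the unit sphere of maximal cardinality is an `ε`-net. -/
theorem exists_net_sphere {ε : ℝ} (hε : 0 < ε) :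
    ∃ N : Finset E, (∀ x ∈ N, ‖x‖ = 1) ∧ (∀ x : E, ‖x‖ = 1 → ∃ y ∈ N, ‖x - y‖ ≤ ε) ∧
      (N.card : ℝ) ≤ (1 + 2 / ε) ^ Module.finrank ℝ E := by
  classical
  let Q : Set ℕ := {k | ∃ s : Finset E, s.card = k ∧ (∀ x ∈ s, ‖x‖ = 1) ∧
    ∀ x ∈ s, ∀ y ∈ s, x ≠ y → ε < ‖x - y‖}
  have hQne : Q.Nonempty := ⟨0, ∅, by simp⟩
  have hQbdd : BddAbove Q := by
    refine ⟨⌊(1 + 2 / ε) ^ Module.finrank ℝ E⌋₊, ?_⟩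
    rintro k ⟨s, rfl, hs, hsep⟩
    exact Nat.le_floor (card_le_of_separated_sphere hε s hs hsep)
  obtain ⟨N, hNcard, hN, hsep⟩ := Nat.sSup_mem hQne hQbdd
  refine ⟨N, hN, fun x hx => ?_, card_le_of_separated_sphere hε N hN hsep⟩
  by_contra! hfar
  have hxN : x ∉ N := fun h => by
    have := hfar x h
    rw [sub_self, norm_zero] at this
    exact hε.not_gt this
  have hmem : N.card + 1 ∈ Q := by
    refine ⟨insert x N, Finset.card_insert_of_notMem hxN, ?_, ?_⟩
    · simpa [Finset.forall_mem_insert] using ⟨hx, hN⟩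
    · intro a ha b hb hab
      rcases Finset.mem_insert.1 ha with hax | ha <;> rcases Finset.mem_insert.1 hb with hbx | hb
      · exact absurd (hax.trans hbx.symm) hab
      · rw [hax]; exact hfar b hb
      · rw [hbx, norm_sub_rev]; exact hfar a ha
      · exact hsep a ha b hb hab
  have := le_csSup hQbdd hmem
  omega

end Net

/-- Two-sided bounds on `‖T y‖` over a net give a lower bound over the whole sphere: the upper bounds
force `‖T‖ ≤ 2 * b`, so moving to the nearest point of the net costs at most `2 * b * ε`. -/
theorem lt_norm_apply_of_net {E F : Type*} [NormedAddCommGroup E] [NormedSpace ℝ E]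
    [NormedAddCommGroup F] [NormedSpace ℝ F]
    (T : E →L[ℝ] F) {ε a b : ℝ} (hε : ε ≤ 1 / 2) (N : Finset E)
    (hb : 0 ≤ b) (hcover : ∀ x : E, ‖x‖ = 1 → ∃ y ∈ N, ‖x - y‖ ≤ ε)
    (hlower : ∀ y ∈ N, a < ‖T y‖) (hupper : ∀ y ∈ N, ‖T y‖ ≤ b) {x : E} (hx : ‖x‖ = 1) :
    a - 2 * b * ε < ‖T x‖ := by
  have hε0 : 0 ≤ ε := by
    obtain ⟨y, -, hy⟩ := hcover x hx
    exact (norm_nonneg _).trans hy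
  have happrox : ∀ x y : E, ‖x - y‖ ≤ ε → ‖T (x - y)‖ ≤ ‖T‖ * ε := fun x y h =>
    (T.le_opNorm _).trans (by gcongr)
  have hop : ‖T‖ ≤ b + ‖T‖ * ε := by
    refine ContinuousLinearMap.opNorm_le_of_unit_norm (by positivity) fun x hx => ?_
    obtain ⟨y, hy, hxy⟩ := hcover x hx
    calc ‖T x‖ = ‖T y + T (x - y)‖ := by rw [← map_add, add_sub_cancel]
      _ ≤ ‖T y‖ + ‖T (x - y)‖ := norm_add_le _ _
      _ ≤ b + ‖T‖ * ε := add_le_add (hupper y hy) (happrox x y hxy)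
  have hop' : ‖T‖ ≤ 2 * b := by nlinarith [norm_nonneg T]
  obtain ⟨y, hy, hxy⟩ := hcover x hx
  have h1 : ‖T y‖ ≤ ‖T x‖ + ‖T (x - y)‖ := by
    have : T y = T x - T (x - y) := by rw [← map_sub, sub_sub_cancel]
    rw [this]
    exact norm_sub_le _ _
  have h2 := happrox x y hxy
  have h3 := hlower y hy
  nlinarith

/-! ### Eigenvalues and the quadratic form of the Gram matrix -/

theorem exists_unit_dotProduct_eq_orderedEigenvalue {n : ℕ} (M : Matrix (Fin n) (Fin n) ℝ)
    (hM : M.IsHermitian) (j : Fin n) :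
    ∃ φ : EuclideanSpace ℝ (Fin n), ‖φ‖ = 1 ∧
      φ.ofLp ⬝ᵥ M.mulVec φ.ofLp = orderedEigenvalue M hM j := by
  let k : Fin n := Fintype.equivOfCardEq (Fintype.card_fin _) (Fin.cast (Fintype.card_fin n).symm j)
  have hk : hM.eigenvalues k = orderedEigenvalue M hM j := by
    simp [Matrix.IsHermitian.eigenvalues, k, orderedEigenvalue]
  have hnorm : ‖hM.eigenvectorBasis k‖ = 1 := hM.eigenvectorBasis.orthonormal.1 k
  refine ⟨hM.eigenvectorBasis k, hnorm, ?_⟩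
  rw [hM.mulVec_eigenvectorBasis, dotProduct_smul, hk]
  have : (hM.eigenvectorBasis k).ofLp ⬝ᵥ (hM.eigenvectorBasis k).ofLp = 1 := by
    have h := EuclideanSpace.norm_sq_eq (hM.eigenvectorBasis k)
    rw [hnorm] at h
    simp only [dotProduct, ← sq]
    simpa using h.symm
  rw [this, smul_eq_mul, mul_one]

theorem dotProduct_gram_mulVec {n p : ℕ} (X : Matrix (Fin n) (Fin p) ℝ) (S : Finset (Fin p))
    (φ : Fin n → ℝ) :
    φ ⬝ᵥ (gram X S).mulVec φ = ∑ i : S, (∑ j, φ j * X j i) ^ 2 := by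
  rw [gram, ← Matrix.mulVec_mulVec, Matrix.dotProduct_mulVec, ← Matrix.mulVec_transpose]
  simp only [dotProduct, ← sq, Matrix.mulVec, Matrix.transpose_apply, colSubmatrix,
    Matrix.submatrix_apply, id]
  simp only [mul_comm]

variable {Ω : Type*} [MeasurableSpace Ω] {P : Measure Ω}

/-! ### Independence of blocks -/

/-- Grouping an independent family indexed by pairs according to the first index gives an independent
family of random vectors. This is a converse of `iIndepFun_uncurry'`. -/
theorem iIndepFun_curry {ι κ 𝓧 : Type*} [MeasurableSpace 𝓧]
    {X : ι → κ → Ω → 𝓧} (mX : ∀ i j, Measurable (X i j))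
    (h : iIndepFun (fun (q : ι × κ) ω => X q.1 q.2 ω) P) :
    iIndepFun (fun i ω => (X i · ω)) P := by
  have := h.isProbabilityMeasure
  have : ∀ i j, IsProbabilityMeasure (P.map (X i j)) :=
    fun i j => Measure.isProbabilityMeasure_map (mX i j).aemeasurable
  have hσ : iIndepFun (fun (q : (_ : ι) × κ) ω => X q.1 q.2 ω) P :=
    h.precomp (Equiv.sigmaEquivProd ι κ).injective
  have hrow : ∀ i, iIndepFun (X i) P := fun i =>
    h.precomp (g := fun j => (i, j)) (Prod.mk_right_injective i)
  have hcomp : (MeasurableEquiv.piCurry fun (_ : ι) (_ : κ) => 𝓧) ∘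
      (fun ω (q : (_ : ι) × κ) => X q.1 q.2 ω) = fun ω i j => X i j ω := by
    ext; simp [Sigma.curry]
  rw [iIndepFun_iff_map_fun_eq_infinitePi_map (by fun_prop)] at hσ ⊢
  rw [← hcomp, ← Measure.map_map (by fun_prop) (by fun_prop), hσ,
    Measure.infinitePi_map_piCurry (fun i j => P.map (X i j))]
  congrm Measure.infinitePi fun i => ?_
  rw [(iIndepFun_iff_map_fun_eq_infinitePi_map (by fun_prop)).1 (hrow i)]

/-! ### Exponential moments and tails in a fixed direction -/

theorem lintegral_rpow_le_rpow_lintegral [IsProbabilityMeasure P] {f : Ω → ℝ≥0∞}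
    (hf : AEMeasurable f P) {a : ℝ} (ha : 0 < a) (ha1 : a ≤ 1) :
    ∫⁻ ω, f ω ^ a ∂P ≤ (∫⁻ ω, f ω ∂P) ^ a := by
  have h := eLpNorm'_le_eLpNorm'_of_exponent_le ha ha1 P hf.aestronglyMeasurable
  simp only [eLpNorm', enorm_eq_self, ENNReal.rpow_one, one_div, inv_one] at h
  calc ∫⁻ ω, f ω ^ a ∂P = ((∫⁻ ω, f ω ^ a ∂P) ^ a⁻¹) ^ a := by
        rw [← ENNReal.rpow_mul, inv_mul_cancel₀ ha.ne', ENNReal.rpow_one]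
    _ ≤ _ := ENNReal.rpow_le_rpow h ha.le

/-- A bound `M` on the exponential moments of the `w i ^ 2` tensorises to `M ^ ∑ i, L i` for weights
`L i ∈ (0, 1]`, by Jensen's inequality for the concave functions `y ↦ y ^ L i`. The sign of `θ` is
arbitrary, so this serves both tails. -/
theorem lintegral_exp_sum_sq_le [IsProbabilityMeasure P] {ι : Type*} [Fintype ι] {w : ι → Ω → ℝ}
    (hw : ∀ i, Measurable (w i)) (hindep : iIndepFun w P) {L : ι → ℝ}
    (hL0 : ∀ i, 0 < L i) (hL1 : ∀ i, L i ≤ 1) (θ : ℝ) {M : ℝ} (hM : 0 < M)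
    (hmom : ∀ i, ∫⁻ ω, ENNReal.ofReal (Real.exp (θ * w i ω ^ 2)) ∂P ≤ ENNReal.ofReal M) :
    ∫⁻ ω, ENNReal.ofReal (Real.exp (θ * ∑ i, L i * w i ω ^ 2)) ∂P
      ≤ ENNReal.ofReal (M ^ ∑ i, L i) := by
  have hpt : ∀ ω, ENNReal.ofReal (Real.exp (θ * ∑ i, L i * w i ω ^ 2)) =
      ∏ i, ENNReal.ofReal (Real.exp (θ * w i ω ^ 2)) ^ L i := fun ω => by
    rw [Finset.mul_sum, Real.exp_sum, ENNReal.ofReal_prod_of_nonneg fun i _ => (Real.exp_pos _).le]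
    refine Finset.prod_congr rfl fun i _ => ?_
    rw [ENNReal.ofReal_rpow_of_pos (Real.exp_pos _), ← Real.exp_mul]
    ring_nf
  have hind : iIndepFun (fun i ω => ENNReal.ofReal (Real.exp (θ * w i ω ^ 2)) ^ L i) P :=
    hindep.comp (fun i y => ENNReal.ofReal (Real.exp (θ * y ^ 2)) ^ L i)
      fun i => by fun_prop
  calc ∫⁻ ω, ENNReal.ofReal (Real.exp (θ * ∑ i, L i * w i ω ^ 2)) ∂P
      = ∏ i, ∫⁻ ω, ENNReal.ofReal (Real.exp (θ * w i ω ^ 2)) ^ L i ∂P := by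
        simp_rw [hpt]
        exact lintegral_prod_eq_prod_lintegral_of_indepFun _ _ hind fun i => by fun_prop
    _ ≤ ∏ i, ENNReal.ofReal M ^ L i := by
        gcongr with i
        refine (lintegral_rpow_le_rpow_lintegral (by fun_prop) (hL0 i) (hL1 i)).trans ?_
        exact ENNReal.rpow_le_rpow (hmom i) (hL0 i).le
    _ = ENNReal.ofReal (M ^ ∑ i, L i) := by
        rw [Real.rpow_sum_of_pos hM, ENNReal.ofReal_prod_of_nonneg fun i _ => by positivity]
        exact Finset.prod_congr rfl fun i _ => ENNReal.ofReal_rpow_of_pos hM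

/-- The exponent `-1 / 4` is not optimal (`-1 / 2` is), but any negative power of `a` suffices below, and
this one follows by splitting at the single level `|w| = a ^ (-1 / 4)`. -/
theorem lintegral_exp_neg_mul_sq_le [IsProbabilityMeasure P] {w : Ω → ℝ} (hw : Measurable w)
    {c : ℝ} (hc : 0 < c) (hsmall : ∀ δ, 0 ≤ δ → P.real {ω | |w ω| ≤ δ} ≤ 2 * c * δ)
    {a : ℝ} (ha : 0 < a) :
    ∫⁻ ω, ENNReal.ofReal (Real.exp (-a * w ω ^ 2)) ∂P
      ≤ ENNReal.ofReal ((2 * c + 1) * a ^ (-(1 / 4) : ℝ)) := by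
  set δ : ℝ := a ^ (-(1 / 4) : ℝ) with hδ
  have hδ0 : 0 < δ := Real.rpow_pos_of_pos ha _
  have hδ4 : a * δ ^ 4 = 1 := by
    rw [hδ, ← Real.rpow_natCast, ← Real.rpow_mul ha.le]
    norm_num
    rw [Real.rpow_neg_one, mul_inv_cancel₀ ha.ne']
  have htail : Real.exp (-a * δ ^ 2) ≤ δ := by
    -- `a δ² = δ⁻²`, and `exp (δ⁻²) ≥ 1 + δ⁻² ≥ δ⁻¹`.
    have h1 : a * δ ^ 2 = δ⁻¹ ^ 2 := by
      field_simp
      linarith [hδ4]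
    rw [neg_mul, h1, Real.exp_neg]
    refine inv_le_of_inv_le₀ hδ0 ?_
    nlinarith [Real.add_one_le_exp (δ⁻¹ ^ 2), sq_nonneg (δ⁻¹ - 1), inv_pos.2 hδ0]
  have hA : MeasurableSet {ω | |w ω| ≤ δ} := measurableSet_le (by fun_prop) measurable_const
  calc ∫⁻ ω, ENNReal.ofReal (Real.exp (-a * w ω ^ 2)) ∂P
      ≤ ∫⁻ ω, ({ω | |w ω| ≤ δ}.indicator (fun _ => 1) ω + ENNReal.ofReal δ) ∂P := by
        refine lintegral_mono fun ω => ?_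
        by_cases h : |w ω| ≤ δ
        · rw [Set.indicator_of_mem (by exact h)]
          refine le_add_right ?_
          rw [ENNReal.ofReal_le_one, Real.exp_le_one_iff]
          nlinarith [sq_nonneg (w ω)]
        · rw [Set.indicator_of_notMem (by exact h), zero_add]
          refine ENNReal.ofReal_le_ofReal (le_trans ?_ htail)
          rw [Real.exp_le_exp]
          have : δ ^ 2 ≤ w ω ^ 2 := by
            rw [← sq_abs (w ω)]
            exact pow_le_pow_left₀ hδ0.le (not_le.1 h).le 2
          nlinarith
    _ = P {ω | |w ω| ≤ δ} + ENNReal.ofReal δ := by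
        rw [lintegral_add_right _ measurable_const, lintegral_indicator_const hA]
        simp
    _ ≤ ENNReal.ofReal (2 * c * δ) + ENNReal.ofReal δ := by
        gcongr
        rw [← ofReal_measureReal]
        exact ENNReal.ofReal_le_ofReal (hsmall δ hδ0.le)
    _ = ENNReal.ofReal ((2 * c + 1) * δ) := by
        rw [← ENNReal.ofReal_add (by positivity) hδ0.le]
        ring_nf

/-- The square is linearised by an independent standard Gaussian variable `g`, through
`exp (y² / 2) = E exp (y g)`, after which Tonelli's theorem allows the moment generating function of
`w` to be used. -/
theorem lintegral_exp_sq_le_of_subgaussian [IsProbabilityMeasure P] {w : Ω → ℝ}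
    (hw : Measurable w) {v : ℝ≥0} (hv : 0 < v) (hsub : HasSubgaussianMGF w v P) :
    ∫⁻ ω, ENNReal.ofReal (Real.exp (1 / (4 * v) * w ω ^ 2)) ∂P ≤ ENNReal.ofReal (√2) := by
  have hv' : (0 : ℝ) < v := hv
  set s : ℝ := √(1 / (2 * v)) with hs
  have hs2 : s ^ 2 = 1 / (2 * v) := Real.sq_sqrt (by positivity)
  have hgauss : ∀ y : ℝ, ENNReal.ofReal (Real.exp (1 / (4 * v) * y ^ 2)) =
      ∫⁻ g, ENNReal.ofReal (Real.exp ((s * y) * g)) ∂(gaussianReal 0 1) := fun y => by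
    rw [← ofReal_integral_eq_lintegral_ofReal (integrable_exp_mul_gaussianReal _)
      (Filter.Eventually.of_forall fun g => (Real.exp_pos _).le)]
    have := congrFun (mgf_fun_id_gaussianReal (μ := 0) (v := 1)) (s * y)
    rw [mgf] at this
    rw [this, mul_pow, hs2]
    congr 2
    push_cast
    field_simp
    ring
  calc ∫⁻ ω, ENNReal.ofReal (Real.exp (1 / (4 * v) * w ω ^ 2)) ∂P
      = ∫⁻ g, ∫⁻ ω, ENNReal.ofReal (Real.exp ((s * w ω) * g)) ∂P ∂(gaussianReal 0 1) := by
        simp_rw [hgauss]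
        exact lintegral_lintegral_swap (by fun_prop)
    _ ≤ ∫⁻ g, ENNReal.ofReal (Real.exp (g ^ 2 / 4)) ∂(gaussianReal 0 1) := by
        refine lintegral_mono fun g => ?_
        have h1 : ∀ ω, (s * w ω) * g = (s * g) * w ω := fun ω => by ring
        simp_rw [h1]
        rw [← ofReal_integral_eq_lintegral_ofReal (hsub.integrable_exp_mul _)
          (Filter.Eventually.of_forall fun g => (Real.exp_pos _).le)]
        refine ENNReal.ofReal_le_ofReal ((hsub.mgf_le (s * g)).trans_eq ?_)
        rw [mul_pow, hs2]
        congr 1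
        field_simp
        norm_num [mul_comm]
    _ = ENNReal.ofReal (√2) := by
        rw [gaussianReal_of_var_ne_zero _ one_ne_zero,
          lintegral_withDensity_eq_lintegral_mul _ (by fun_prop) (by fun_prop)]
        have h2 : ∀ g : ℝ, (gaussianPDF 0 1 * fun g => ENNReal.ofReal (Real.exp (g ^ 2 / 4))) g =
            ENNReal.ofReal ((√(2 * Real.pi))⁻¹ * Real.exp (-(1 / 4) * g ^ 2)) := fun g => by
          rw [Pi.mul_apply, gaussianPDF, ← ENNReal.ofReal_mul (gaussianPDFReal_nonneg _ _ _),
            gaussianPDFReal, mul_assoc, ← Real.exp_add]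
          congr 3
          · simp
          · push_cast; ring
        simp_rw [h2]
        rw [← ofReal_integral_eq_lintegral_ofReal
          ((integrable_exp_neg_mul_sq (by norm_num)).const_mul _)
          (Filter.Eventually.of_forall fun g => by positivity), integral_const_mul,
          integral_gaussian]
        congr 1
        rw [inv_mul_eq_iff_eq_mul₀ (by positivity), ← Real.sqrt_mul (by positivity)]
        congr 1
        ring

/-- Lower tail of the quadratic form in a fixed direction. -/
theorem measureReal_sum_sq_le [IsProbabilityMeasure P] {ι : Type*} [Fintype ι] {w : ι → Ω → ℝ}
    (hw : ∀ i, Measurable (w i)) (hindep : iIndepFun w P) {L : ι → ℝ}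
    (hL0 : ∀ i, 0 < L i) (hL1 : ∀ i, L i ≤ 1) {c : ℝ} (hc : 0 < c)
    (hsmall : ∀ i δ, 0 ≤ δ → P.real {ω | |w i ω| ≤ δ} ≤ 2 * c * δ) {t : ℝ} (ht : 0 < t) :
    P.real {ω | ∑ i, L i * w i ω ^ 2 ≤ 4 * t * ∑ i, L i}
      ≤ (Real.exp 4 * (2 * c + 1) * t ^ (1 / 4 : ℝ)) ^ ∑ i, L i := by
  set r := ∑ i, L i
  have hM : 0 < (2 * c + 1) * (1 / t) ^ (-(1 / 4) : ℝ) := by positivity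
  have hmgf := lintegral_exp_sum_sq_le hw hindep hL0 hL1 (-(1 / t)) hM fun i =>
    lintegral_exp_neg_mul_sq_le (hw i) hc (hsmall i) (by positivity)
  have hsub : {ω | ∑ i, L i * w i ω ^ 2 ≤ 4 * t * r} ⊆
      {ω | ENNReal.ofReal (Real.exp (-(4 * r))) ≤
        ENNReal.ofReal (Real.exp (-(1 / t) * ∑ i, L i * w i ω ^ 2))} := fun ω hω => by
    refine ENNReal.ofReal_le_ofReal (Real.exp_le_exp.2 ?_)
    have hω' : ∑ i, L i * w i ω ^ 2 ≤ 4 * t * r := hω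
    rw [neg_mul, neg_le_neg_iff, one_div_mul_eq_div, div_le_iff₀ ht]
    linarith
  have hmarkov := (mul_le_mul_right (measure_mono hsub) _).trans
    ((mul_meas_ge_le_lintegral (by fun_prop) _).trans hmgf)
  rw [← ofReal_measureReal, ← ENNReal.ofReal_mul (Real.exp_pos _).le,
    ENNReal.ofReal_le_ofReal_iff (by positivity)] at hmarkov
  have ht4 : (1 / t) ^ (-(1 / 4) : ℝ) = t ^ (1 / 4 : ℝ) := by
    rw [one_div, Real.inv_rpow ht.le, Real.rpow_neg ht.le, inv_inv]
  rw [ht4, Real.exp_neg, inv_mul_le_iff₀ (Real.exp_pos _)] at hmarkov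
  rwa [mul_assoc (Real.exp 4), Real.mul_rpow (Real.exp_pos _).le (by positivity), ← Real.exp_mul]

/-- Upper tail of the quadratic form in a fixed direction. -/
theorem measureReal_le_sum_sq [IsProbabilityMeasure P] {ι : Type*} [Fintype ι] {w : ι → Ω → ℝ}
    (hw : ∀ i, Measurable (w i)) (hindep : iIndepFun w P) {L : ι → ℝ}
    (hL0 : ∀ i, 0 < L i) (hL1 : ∀ i, L i ≤ 1) {v : ℝ≥0} (hv : 0 < v)
    (hsub : ∀ i, HasSubgaussianMGF (w i) v P) {t : ℝ} (ht : 0 < t) :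
    P.real {ω | (∑ i, L i) / t ≤ ∑ i, L i * w i ω ^ 2}
      ≤ (4 * v * √2 * t) ^ ∑ i, L i := by
  set r := ∑ i, L i
  have hr : 0 ≤ r := Finset.sum_nonneg fun i _ => (hL0 i).le
  have hv' : (0 : ℝ) < v := hv
  have hmgf := lintegral_exp_sum_sq_le hw hindep hL0 hL1 (1 / (4 * v)) (M := √2) (by positivity)
    fun i => lintegral_exp_sq_le_of_subgaussian (hw i) hv (hsub i)
  have hsub : {ω | r / t ≤ ∑ i, L i * w i ω ^ 2} ⊆
      {ω | ENNReal.ofReal ((1 / (4 * v * t)) ^ r) ≤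
        ENNReal.ofReal (Real.exp (1 / (4 * v) * ∑ i, L i * w i ω ^ 2))} := fun ω hω => by
    have hω' : r / t ≤ ∑ i, L i * w i ω ^ 2 := hω
    refine ENNReal.ofReal_le_ofReal ?_
    -- `exp` is replaced by a power: only a bound of the form `(C t) ^ r` is needed.
    calc (1 / (4 * v * t)) ^ r ≤ Real.exp (1 / (4 * v * t)) ^ r := by
          gcongr
          linarith [Real.add_one_le_exp (1 / (4 * v * t))]
      _ = Real.exp (1 / (4 * v) * (r / t)) := by
          rw [← Real.exp_mul]
          congr 1
          field_simp
      _ ≤ _ := by gcongr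
  have hmarkov := (mul_le_mul_right (measure_mono hsub) _).trans
    ((mul_meas_ge_le_lintegral (by fun_prop) _).trans hmgf)
  rw [← ofReal_measureReal, ← ENNReal.ofReal_mul (by positivity),
    ENNReal.ofReal_le_ofReal_iff (by positivity), one_div, Real.inv_rpow (by positivity),
    inv_mul_le_iff₀ (by positivity), ← Real.mul_rpow (by positivity) (by positivity)] at hmarkov
  refine hmarkov.trans_eq ?_
  ring_nf

/-! ### Uniformity over the sphere -/

/-- Lower tail of the quadratic form, uniformly over all directions: the union bound over a `t / 2`-net
of the sphere. -/
theorem measureReal_exists_unit_sum_sq_le [IsProbabilityMeasure P] {n : ℕ} (hn : 0 < n)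
    {ι : Type*} [Fintype ι] {z : ι → Ω → Fin n → ℝ} (hz : ∀ i, Measurable (z i))
    (hindep : iIndepFun z P) {L : ι → ℝ} (hL0 : ∀ i, 0 < L i) (hL1 : ∀ i, L i ≤ 1)
    (hL : 8 * (n : ℝ) ≤ ∑ i, L i) {c : ℝ} (hc : 0 < c)
    (hsmall : ∀ φ : EuclideanSpace ℝ (Fin n), ‖φ‖ = 1 → ∀ i δ, 0 ≤ δ →
      P.real {ω | |∑ j, φ j * z i ω j| ≤ δ} ≤ 2 * c * δ)
    {v : ℝ≥0} (hv : 0 < v)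
    (hsub : ∀ φ : EuclideanSpace ℝ (Fin n), ‖φ‖ = 1 → ∀ i,
      HasSubgaussianMGF (fun ω => ∑ j, φ j * z i ω j) v P)
    {t : ℝ} (ht0 : 0 < t) (ht1 : t < 1 / 2) :
    P.real {ω | ∃ φ : EuclideanSpace ℝ (Fin n), ‖φ‖ = 1 ∧
        ∑ i, L i * (∑ j, φ j * z i ω j) ^ 2 ≤ t * ∑ i, L i}
      ≤ (1280 * (Real.exp 4 * (2 * c + 1) + 4 * v * √2) ^ 8 * t) ^ ((∑ i, L i) / 8) := by
  set r := ∑ i, L i with hr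
  set A := Real.exp 4 * (2 * c + 1) + 4 * v * √2 with hA
  have hA0 : 0 < A := by positivity
  have hn1 : (1 : ℝ) ≤ n := by exact_mod_cast hn
  have hr1 : 1 ≤ r := by linarith
  obtain ⟨N, hN1, hNcover, hNcard⟩ :=
    exists_net_sphere (E := EuclideanSpace ℝ (Fin n)) (ε := t / 2) (by positivity)
  let low : EuclideanSpace ℝ (Fin n) → Set Ω := fun φ =>
    {ω | ∑ i, L i * (∑ j, φ j * z i ω j) ^ 2 ≤ 4 * t * r}
  let high : EuclideanSpace ℝ (Fin n) → Set Ω := fun φ =>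
    {ω | r / t ≤ ∑ i, L i * (∑ j, φ j * z i ω j) ^ 2}
  have hincl : {ω | ∃ φ : EuclideanSpace ℝ (Fin n), ‖φ‖ = 1 ∧
      ∑ i, L i * (∑ j, φ j * z i ω j) ^ 2 ≤ t * r} ⊆ ⋃ φ ∈ N, (low φ ∪ high φ) := by
    rintro ω ⟨ψ, hψ, hψle⟩
    by_contra hω
    simp only [Set.mem_iUnion, Set.mem_union, not_exists, not_or] at hω
    let T : EuclideanSpace ℝ (Fin n) →L[ℝ] EuclideanSpace ℝ ι :=
      (Matrix.toLpLin 2 2 (Matrix.of fun i j => √(L i) * z i ω j)).toContinuousLinearMap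
    have hT : ∀ φ, ‖T φ‖ ^ 2 = ∑ i, L i * (∑ j, φ j * z i ω j) ^ 2 := fun φ => by
      rw [EuclideanSpace.norm_sq_eq]
      refine Finset.sum_congr rfl fun i _ => ?_
      have : T φ i = √(L i) * ∑ j, φ j * z i ω j := by
        simp only [T, LinearMap.coe_toContinuousLinearMap', Matrix.toLpLin_apply, Matrix.mulVec,
          dotProduct, Matrix.of_apply, Finset.mul_sum]
        exact Finset.sum_congr rfl fun j _ => by ring
      rw [this, Real.norm_eq_abs, sq_abs, mul_pow, Real.sq_sqrt (hL0 i).le]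
    -- On the net, `√(4 t r) < ‖T φ‖ ≤ √(r / t)`.
    have hlt := lt_norm_apply_of_net T (ε := t / 2) (a := √(4 * t * r)) (b := √(r / t))
      (by linarith) N (Real.sqrt_nonneg _) hNcover
      (fun y hy => by
        rw [Real.sqrt_lt' (norm_pos_iff.2 fun h0 => ?_), hT]
        · exact not_le.1 (hω y hy).1
        · refine (hω y hy).1 ?_
          rw [Set.mem_ofPred_eq, ← hT, h0, norm_zero, zero_pow two_ne_zero]
          positivity)
      (fun y hy => by
        refine Real.le_sqrt_of_sq_le ?_
        rw [hT]
        exact (not_le.1 (hω y hy).2).le) hψ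
    -- The error term is `√(r / t) * t = √(t * r)`, half of the lower bound on the net.
    have h1 : √(4 * t * r) = 2 * √(t * r) := by
      rw [mul_assoc, Real.sqrt_mul (by norm_num), show (4 : ℝ) = 2 ^ 2 by norm_num,
        Real.sqrt_sq (by norm_num)]
    have h2 : √(r / t) * t = √(t * r) := by
      rw [← Real.sqrt_sq ht0.le, ← Real.sqrt_mul (by positivity), Real.sqrt_sq ht0.le]
      congr 1
      field_simp
    have h3 : √(t * r) < ‖T ψ‖ := by nlinarith
    rw [← hT] at hψle
    exact absurd hψle (not_le.2 ((Real.sqrt_lt' ((Real.sqrt_nonneg _).trans_lt h3)).1 h3))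
  have hwmeas : ∀ (φ : EuclideanSpace ℝ (Fin n)) i,
      Measurable fun ω => ∑ j, φ j * z i ω j := fun φ i => by
    have := hz i
    fun_prop
  have hwindep : ∀ φ : EuclideanSpace ℝ (Fin n),
      iIndepFun (fun i ω => ∑ j, φ j * z i ω j) P := fun φ =>
    hindep.comp (fun _ y => ∑ j, φ j * y j) fun _ => by fun_prop
  have hpoint : ∀ φ ∈ N, P.real (low φ ∪ high φ) ≤ (2 * A * t ^ (1 / 4 : ℝ)) ^ r := by
    intro φ hφ
    have hlow := measureReal_sum_sq_le (hwmeas φ) (hwindep φ) hL0 hL1 hc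
      (hsmall φ (hN1 φ hφ)) ht0
    have hhigh := measureReal_le_sum_sq (hwmeas φ) (hwindep φ) hL0 hL1 hv
      (hsub φ (hN1 φ hφ)) ht0
    have ht4 : t ≤ t ^ (1 / 4 : ℝ) := by
      conv_lhs => rw [← Real.rpow_one t]
      exact Real.rpow_le_rpow_of_exponent_ge ht0 (by linarith) (by norm_num)
    calc P.real (low φ ∪ high φ) ≤ P.real (low φ) + P.real (high φ) := measureReal_union_le _ _
      _ ≤ (A * t ^ (1 / 4 : ℝ)) ^ r + (A * t ^ (1 / 4 : ℝ)) ^ r := by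
          refine add_le_add (hlow.trans ?_) (hhigh.trans ?_)
          · gcongr
            rw [hA]
            exact le_add_of_nonneg_right (by positivity)
          · gcongr
            rw [hA]
            exact le_add_of_nonneg_left (by positivity)
      _ = 2 * (A * t ^ (1 / 4 : ℝ)) ^ r := by ring
      _ ≤ 2 ^ r * (A * t ^ (1 / 4 : ℝ)) ^ r := by
          gcongr
          conv_lhs => rw [← Real.rpow_one 2]
          exact Real.rpow_le_rpow_of_exponent_le (by norm_num) hr1
      _ = (2 * A * t ^ (1 / 4 : ℝ)) ^ r := by
          rw [← Real.mul_rpow (by norm_num) (by positivity), mul_assoc]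
  have hcard : (N.card : ℝ) ≤ (5 / t) ^ (r / 8) := by
    rw [finrank_euclideanSpace_fin] at hNcard
    have h5 : 1 ≤ 5 / t := by rw [le_div_iff₀ ht0]; linarith
    calc (N.card : ℝ) ≤ (1 + 2 / (t / 2)) ^ n := hNcard
      _ ≤ (5 / t) ^ n := by
          gcongr
          rw [le_div_iff₀ ht0]
          field_simp
          linarith
      _ = (5 / t) ^ (n : ℝ) := (Real.rpow_natCast _ _).symm
      _ ≤ (5 / t) ^ (r / 8) := Real.rpow_le_rpow_of_exponent_le h5 (by linarith)
  calc _ ≤ P.real (⋃ φ ∈ N, (low φ ∪ high φ)) := measureReal_mono hincl (measure_ne_top P _)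
    _ ≤ ∑ φ ∈ N, P.real (low φ ∪ high φ) := measureReal_biUnion_finset_le _ _
    _ ≤ ∑ φ ∈ N, (2 * A * t ^ (1 / 4 : ℝ)) ^ r := Finset.sum_le_sum hpoint
    _ = N.card * (2 * A * t ^ (1 / 4 : ℝ)) ^ r := by rw [Finset.sum_const, nsmul_eq_mul]
    _ ≤ (5 / t) ^ (r / 8) * (2 * A * t ^ (1 / 4 : ℝ)) ^ r := by gcongr
    _ = (5 / t) ^ (r / 8) * (2 ^ 8 * A ^ 8 * t ^ 2) ^ (r / 8) := by
        have ht8 : (t ^ (1 / 4 : ℝ)) ^ 8 = t ^ 2 := by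
          rw [← Real.rpow_natCast, ← Real.rpow_mul ht0.le, ← Real.rpow_natCast]
          norm_num
        rw [← ht8, ← mul_pow, ← mul_pow, ← Real.rpow_natCast (2 * A * t ^ (1 / 4 : ℝ)) 8,
          ← Real.rpow_mul (by positivity)]
        congr 2
        push_cast
        ring
    _ = (1280 * A ^ 8 * t) ^ (r / 8) := by
        rw [← Real.mul_rpow (by positivity) (by positivity)]
        congr 1
        field_simp
        norm_num

/-! ### Columns of the data matrix -/

/-- The normalised features are the components of `u`. -/
theorem IsFeatureVector.ae_eq_mul {p : ℕ} {σx : ℝ} {lam : Fin p → ℝ} {x u : Ω → Fin p → ℝ}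
    (hx : IsFeatureVector P σx lam x u) (i : Fin p) :
    (fun ω => (√(lam i))⁻¹ * x ω i) =ᵐ[P] fun ω => u ω i := by
  filter_upwards [hx.x_eq] with ω hω
  rw [hω, covSqrt, Matrix.mulVec_diagonal,
    inv_mul_cancel_left₀ (Real.sqrt_pos.2 (hx.lam_pos i)).ne']

theorem IsFeatureVector.hasSubgaussianMGF {p : ℕ} {σx : ℝ} {lam : Fin p → ℝ}
    {x u : Ω → Fin p → ℝ} (hx : IsFeatureVector P σx lam x u) (i : Fin p) :
    HasSubgaussianMGF (fun ω => u ω i) (σx ^ 2).toNNReal P := by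
  have h := fun s : ℝ => hx.subgaussian (EuclideanSpace.single i s)
  simp only [PiLp.single_apply, ite_mul, zero_mul, Finset.sum_ite_eq', Finset.mem_univ, if_true,
    PiLp.norm_single, Real.norm_eq_abs, sq_abs] at h
  refine ⟨fun s => (h s).1, fun s => ?_⟩
  rw [Real.coe_toNNReal _ (sq_nonneg σx)]
  exact (h s).2

/-- All normalised entries of the data matrix are independent, indexed by (column, row). -/
theorem IsIIDSample.iIndepFun_columns [IsProbabilityMeasure P] {n p : ℕ} {σx : ℝ}
    {lam : Fin p → ℝ} {x u : Ω → Fin p → ℝ} {xs : Fin n → Ω → Fin p → ℝ}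
    (hx : IsFeatureVector P σx lam x u) (hxs : IsIIDSample P x xs) :
    iIndepFun (fun (q : Fin p × Fin n) ω => (√(lam q.1))⁻¹ * xs q.2 ω q.1) P := by
  have hmeas := hxs.measurable
  have hxind : iIndepFun (fun i ω => (√(lam i))⁻¹ * x ω i) P :=
    hx.indep_components.congr fun i => (hx.ae_eq_mul i).symm
  have hrow : ∀ j, iIndepFun (fun i ω => (√(lam i))⁻¹ * xs j ω i) P := fun j => by
    have hid : IdentDistrib (fun ω i => (√(lam i))⁻¹ * xs j ω i)
        (fun ω i => (√(lam i))⁻¹ * x ω i) P P :=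
      (hxs.identDistrib j).comp (u := fun (y : Fin p → ℝ) i => (√(lam i))⁻¹ * y i)
        (by fun_prop)
    have hmx := hx.measurable_x
    rw [iIndepFun_iff_map_fun_eq_pi_map fun i => by fun_prop] at hxind ⊢
    rw [hid.map_eq, hxind]
    congr 1
    ext1 i
    exact (hid.comp (measurable_pi_apply i)).map_eq.symm
  have hrows : iIndepFun (fun j ω i => (√(lam i))⁻¹ * xs j ω i) P :=
    hxs.indep.comp (fun _ y i => (√(lam i))⁻¹ * y i) fun _ => by fun_prop
  exact (iIndepFun_uncurry' (fun j i => by fun_prop) hrows hrow).precomp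
    (g := Prod.swap) Prod.swap_injective

theorem IsIIDSample.hasSubgaussianMGF_sum [IsProbabilityMeasure P] {n p : ℕ} {σx : ℝ}
    {lam : Fin p → ℝ} {x u : Ω → Fin p → ℝ} {xs : Fin n → Ω → Fin p → ℝ}
    (hx : IsFeatureVector P σx lam x u) (hxs : IsIIDSample P x xs)
    {φ : EuclideanSpace ℝ (Fin n)} (hφ : ‖φ‖ = 1) (i : Fin p) :
    HasSubgaussianMGF (fun ω => ∑ j, φ j * ((√(lam i))⁻¹ * xs j ω i)) (σx ^ 2).toNNReal P := by
  have hent : ∀ j, HasSubgaussianMGF (fun ω => (√(lam i))⁻¹ * xs j ω i)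
      (σx ^ 2).toNNReal P := fun j =>
    ((hx.hasSubgaussianMGF i).congr (hx.ae_eq_mul i).symm).congr_identDistrib
      ((hxs.identDistrib j).comp (u := fun y : Fin p → ℝ => (√(lam i))⁻¹ * y i)
        (by fun_prop)).symm
  have hind : iIndepFun (fun j ω => (√(lam i))⁻¹ * xs j ω i) P :=
    (hxs.iIndepFun_columns hx).precomp (g := fun j => (i, j)) (Prod.mk_right_injective i)
  have hind' : iIndepFun (fun j ω => φ j * ((√(lam i))⁻¹ * xs j ω i)) P :=
    hind.comp (fun j y => φ j * y) fun j => by fun_prop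
  have h := HasSubgaussianMGF.sum_of_iIndepFun hind' (s := Finset.univ)
    (c := fun j => (φ j ^ 2).toNNReal * (σx ^ 2).toNNReal) fun j _ => by
      rw [Real.toNNReal_of_nonneg (sq_nonneg (φ j))]
      exact (hent j).const_mul (φ j)
  have hφ2 : ∑ j, φ j ^ 2 = 1 := by
    have h2 := EuclideanSpace.norm_sq_eq φ
    rw [hφ] at h2
    simpa using h2.symm
  rwa [← Finset.sum_mul, ← Real.toNNReal_sum_of_nonneg fun j _ => sq_nonneg (φ j), hφ2,
    Real.toNNReal_one, one_mul] at h

theorem AntiConcentrated.measureReal_abs_le {n p : ℕ} {c : ℝ} {lam : Fin p → ℝ}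
    {xs : Fin n → Ω → Fin p → ℝ} (h : AntiConcentrated P c lam (dataMatrix xs))
    {φ : EuclideanSpace ℝ (Fin n)} (hφ : ‖φ‖ = 1) (i : Fin p) {δ : ℝ} (hδ : 0 ≤ δ) :
    P.real {ω | |∑ j, φ j * ((√(lam i))⁻¹ * xs j ω i)| ≤ δ} ≤ 2 * c * δ := by
  have h1 := h φ hφ (-δ) δ (by linarith) i
  rw [sub_neg_eq_add, abs_of_nonneg (by linarith), show c * (δ + δ) = 2 * c * δ by ring] at h1
  have hcoord : ∀ ω, (covInvSqrt lam).mulVec ((dataMatrix xs ω).transpose.mulVec φ.ofLp) i =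
      ∑ j, φ j * ((√(lam i))⁻¹ * xs j ω i) := fun ω => by
    rw [covInvSqrt, Matrix.mulVec_diagonal]
    simp only [Matrix.mulVec, dotProduct, Matrix.transpose_apply, dataMatrix, Matrix.of_apply,
      Finset.mul_sum]
    exact Finset.sum_congr rfl fun j _ => by ring
  simpa only [hcoord, Set.mem_Icc, ← abs_le] using h1

/-! ### The smallest eigenvalue -/

/-- The eigenvalue bound for positive `t`. It holds for every eigenvalue, as each of them is a value of
the quadratic form on the unit sphere. -/
theorem measureReal_orderedEigenvalue_gram_le [IsProbabilityMeasure P] {σx c : ℝ} (hσx : 0 < σx)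
    (hc : 0 < c) {n p : ℕ} (hn : 0 < n) {lam : Fin p → ℝ} {x u : Ω → Fin p → ℝ}
    {xs : Fin n → Ω → Fin p → ℝ} (hx : IsFeatureVector P σx lam x u) (hxs : IsIIDSample P x xs)
    (hanti : AntiConcentrated P c lam (dataMatrix xs)) (S : Finset (Fin p)) (hS : S.Nonempty)
    (hr : 8 * (n : ℝ) ≤ effectiveRank lam S hS) (k : Fin n) {t : ℝ} (ht0 : 0 < t)
    (ht1 : t < 1 / 2) :
    P.real {ω | orderedEigenvalue (gram (dataMatrix xs ω) S)
        (gram_isHermitian (dataMatrix xs ω) S) k ≤ t * partialTrace lam S}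
      ≤ (1280 * (Real.exp 4 * (2 * c + 1) + 4 * σx ^ 2 * √2) ^ 8 * t)
          ^ (effectiveRank lam S hS / 8) := by
  set m := S.sup' hS lam with hm
  have hle : ∀ i : S, lam i ≤ m := fun i => Finset.le_sup' lam i.2
  have hm0 : 0 < m := by
    obtain ⟨i, hi⟩ := hS
    exact (hx.lam_pos i).trans_le (hle ⟨i, hi⟩)
  have hsum : ∑ i : S, lam i / m = effectiveRank lam S hS := by
    rw [effectiveRank, partialTrace, ← Finset.sum_div, Finset.sum_coe_sort S lam]
  have hmeas := hxs.measurable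
  have hcols : iIndepFun (fun (i : Fin p) ω (j : Fin n) => (√(lam i))⁻¹ * xs j ω i) P :=
    iIndepFun_curry (X := fun i j ω => (√(lam i))⁻¹ * xs j ω i) (fun i j => by fun_prop)
      (hxs.iIndepFun_columns hx)
  have key := measureReal_exists_unit_sum_sq_le hn
    (z := fun (i : S) ω (j : Fin n) => (√(lam i))⁻¹ * xs j ω i) (fun i => by fun_prop)
    (hcols.precomp Subtype.val_injective) (L := fun i : S => lam i / m)
    (fun i => div_pos (hx.lam_pos i) hm0) (fun i => (div_le_one hm0).2 (hle i))
    (hsum ▸ hr) hc (fun φ hφ i δ hδ => hanti.measureReal_abs_le hφ i hδ)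
    (v := (σx ^ 2).toNNReal) (Real.toNNReal_pos.2 (pow_pos hσx 2))
    (fun φ hφ i => hxs.hasSubgaussianMGF_sum hx hφ i) ht0 ht1
  rw [hsum, Real.coe_toNNReal _ (sq_nonneg σx)] at key
  refine (measureReal_mono fun ω hω => ?_).trans key
  have hω' : orderedEigenvalue (gram (dataMatrix xs ω) S)
      (gram_isHermitian (dataMatrix xs ω) S) k ≤ t * partialTrace lam S := hω
  obtain ⟨φ, hφ, heig⟩ := exists_unit_dotProduct_eq_orderedEigenvalue _
    (gram_isHermitian (dataMatrix xs ω) S) k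
  rw [← heig, dotProduct_gram_mulVec] at hω'
  refine ⟨φ, hφ, ?_⟩
  have hterm : ∀ i : S, lam i / m * (∑ j, φ j * ((√(lam i))⁻¹ * xs j ω i)) ^ 2 =
      (∑ j, φ j * dataMatrix xs ω j i) ^ 2 / m := fun i => by
    have h1 : ∑ j, φ j * ((√(lam i))⁻¹ * xs j ω i) =
        (√(lam i))⁻¹ * ∑ j, φ j * dataMatrix xs ω j i := by
      rw [Finset.mul_sum]
      exact Finset.sum_congr rfl fun j _ => by rw [dataMatrix, Matrix.of_apply]; ring
    have hpos := hx.lam_pos i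
    rw [h1, mul_pow, inv_pow, Real.sq_sqrt hpos.le]
    field_simp
  simp_rw [hterm]
  rw [← Finset.sum_div, effectiveRank, ← mul_div_assoc]
  exact div_le_div_of_nonneg_right hω' hm0.le

end BenignLinear

theorem mainTheorem4 (σx c : ℝ) (hσx : 0 < σx) (hc : 0 < c) :
    ∃ c₀ c₁ c₂ c₃ : ℝ, 0 < c₀ ∧ 0 < c₁ ∧ c₁ < 1 ∧ 0 < c₂ ∧ 0 < c₃ ∧
      ∀ (n p : ℕ) (hn : 0 < n), n < p →
      ∀ (Ω : Type*) [MeasurableSpace Ω] (P : MeasureTheory.Measure Ω)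
        [MeasureTheory.IsProbabilityMeasure P]
        (lam : Fin p → ℝ) (x u : Ω → Fin p → ℝ) (xs : Fin n → Ω → Fin p → ℝ),
        BenignLinear.IsFeatureVector P σx lam x u →
        BenignLinear.IsIIDSample P x xs →
        BenignLinear.AntiConcentrated P c lam (BenignLinear.dataMatrix xs) →
        ∀ (S : Finset (Fin p)) (hS : S.Nonempty),
          c₀ * (n : ℝ) ≤ BenignLinear.effectiveRank lam S hS →
          ∀ t : ℝ, 0 ≤ t → t < c₁ →
            P.real {ω | BenignLinear.orderedEigenvalue
                (BenignLinear.gram (BenignLinear.dataMatrix xs ω) S)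
                (BenignLinear.gram_isHermitian (BenignLinear.dataMatrix xs ω) S)
                ⟨n - 1, Nat.sub_lt hn Nat.one_pos⟩ ≤ t * BenignLinear.partialTrace lam S}
              ≤ (c₂ * t) ^ (c₃ * BenignLinear.effectiveRank lam S hS) := by
  refine ⟨8, 1 / 2, 1280 * (Real.exp 4 * (2 * c + 1) + 4 * σx ^ 2 * √2) ^ 8, 1 / 8, by norm_num,
    by norm_num, by norm_num, by positivity, by norm_num, ?_⟩
  intro n p hn _ Ω _ P _ lam x u xs hx hxs hanti S hS hr t ht0 ht1
  have hn0 : (0 : ℝ) < n := by exact_mod_cast hn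
  have hexp : 0 ≤ 1 / 8 * BenignLinear.effectiveRank lam S hS := by linarith
  have htrace : 0 ≤ BenignLinear.partialTrace lam S :=
    Finset.sum_nonneg fun i _ => (hx.lam_pos i).le
  have hcont : Filter.Tendsto (fun s : ℝ =>
      (1280 * (Real.exp 4 * (2 * c + 1) + 4 * σx ^ 2 * √2) ^ 8 * s) ^
        (1 / 8 * BenignLinear.effectiveRank lam S hS)) (nhdsWithin t (Set.Ioi t))
      (nhds ((1280 * (Real.exp 4 * (2 * c + 1) + 4 * σx ^ 2 * √2) ^ 8 * t) ^
        (1 / 8 * BenignLinear.effectiveRank lam S hS))) :=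
    (((continuous_const.mul continuous_id).rpow_const fun _ => Or.inr hexp).tendsto t).mono_left
      nhdsWithin_le_nhds
  -- The bound at `t` is the limit of the bounds at `s ↓ t`; this covers the case `t = 0`.
  refine ge_of_tendsto hcont ?_
  filter_upwards [Ioo_mem_nhdsGT ht1] with s hs
  rw [one_div_mul_eq_div]
  refine (MeasureTheory.measureReal_mono fun ω hω => ?_).trans
    (BenignLinear.measureReal_orderedEigenvalue_gram_le hσx hc hn hx hxs hanti S hS hr
      ⟨n - 1, Nat.sub_lt hn Nat.one_pos⟩ (ht0.trans_lt hs.1) hs.2)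
  exact le_trans (Set.mem_ofPred_eq.mp hω) (mul_le_mul_of_nonneg_right hs.1.le htrace)
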